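/- **Setting.** There are $n$ processes with identifiers $1,\dots,n$ on a complete asynchronous network with authenticated private channels and arbitrary message delays. A set $F$ of at most $t$ processes is faulty (arbitrary behaviour); the others are correct. Each process passes through rounds $1,2,\dots$. In round $r$ the processes run instances of the secret sharing protocol IVSS[$r$], and the certification protocol runs throughout. "A-Cast" is Bracha's broadcast: the sender sends $u$ to all; on the first such message a process echoes $u$ to all; on $n-t$ echoes of $u$ or $t+1$ messages "ready $u$" it sends "ready $u$" to all; on $2t+1$ messages "ready $u$" it receives $u$. Univariate polynomials have degree at most $t$ and integer coefficients; bivariate ones have degree at most $t$ in each variable. **Sharing in an instance $\mathbb I$ of IVSS[$r$].** 1. The dealer chooses a symmetric bivariate $f$ with $f(0,0)$ its secret and sends $f_i=f(i,\cdot)$ to each process $i$. 2. A process $k$ that accepts a polynomial $\widehat f_k$ from the dealer (only one is accepted) sends $\widehat f_k(i)$ to each $i$. 3. If $k$ receives from $i$ a value equal to $\widehat f_k(i)$, it A-Casts "equal: $(k,i)$". 4. The dealer A-Casts a candidate set $\mathcal M$ of $n-t$ processes such that for all $i,j,p,q\in\mathcal M$ it has received "equal: $(i,j)$" from $i$ and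 "checked$_r$: $p,q,\{i,j\}$" from $p$. 5. A process that has received $\mathcal M$ from the dealer and has itself received all these messages completes the sharing. **Reconstruction in $\mathbb I$** (by processes that have completed the sharing). 1. Each $k\in\mathcal M$ A-Casts $\widehat f_k$. 2. While in round $r$, process $k$ may take a set of $n-2t$ members $i$ of $\mathcal M$ from which it has received polynomials $\widetilde f_i$, such that some symmetric bivariate polynomial $\bar f$ satisfies $\bar f(i,j)=\widetilde f_i(j)$ for all $i$ in this set and all $j\in\mathcal M$. It then sets $v=\bar f(0,0)$ (once per instance), adds $\mathbb I$ to its set $\mathrm{CoreInvocations}^k_r$ and A-Casts "ready to complete". 3. After step 2 and after receiving "ready to complete" from $n-t$ processes, $k$ outputs $v$. **Certification.** At the beginning of round $r\ge 1$, process $k$ sets $\mathrm{CoreInvocations}^k_r=\varnothing$ and A-Casts $\mathrm{CoreInvocations}^k_{r-1}$ (with $\mathrm{CoreInvocations}^k_0=\varnothing$). Process $k$ infers the pair $\{i,j\}$ if, for an instance $\mathbb I$ in a set $\mathrm{CoreInvocations}^l_{r}$ that it has received from some $l$, it has received the candidate set $\mathcal M\ni i,j$ of $\mathbb I$ and polynomials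 $\widetilde f_i,\widetilde f_j$ A-Cast in $\mathbb I$ by $i$ and $j$ with $\widetilde f_i(j)\ne\widetilde f_j(i)$. It A-Casts "checked$_r$: $k,l,\{i,j\}$" only if it has received $\mathrm{CoreInvocations}^l_{r'}$ from $l$ for all $r'<r$, has received the candidate set of each instance in these sets and the polynomial of each of $i,j$ belonging to that candidate set, and has not inferred $\{i,j\}$. **Event $\mathbb E$.** Let $C$ be the set of correct processes in the candidate set $\mathcal M$ of an instance $\mathbb I$ whose sharing some correct process has completed. The secret defined by $\mathbb I$ is $s=g(0,0)$, where $g$ is the symmetric bivariate polynomial with $g(i,j)=\widehat f_i(j)$ for all $i,j\in C$. Event $\mathbb E$ occurs in $\mathbb I$ if some correct process outputs a value $s'\neq s$ in the reconstruction of $\mathbb I$. It occurs in round $r$ if it occurs in some instance of IVSS[$r$]. **Lemma.** Let $n=3t+\delta$ with an integer $\delta\ge 1$. In every execution with at most $t$ faulty processes, whatever the schedule, the choices of the processes (which instances they run and when they pass to the next round) and the behaviour of the faulty processes, the number of rounds in which $\mathbb E$ occurs is finite and at most $$\frac{3t}{\delta}+1 .$$ -/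

import Mathlib

namespace IVSS

/-! ### Polynomials -/

/-- The identifier of a process, an element of `{1, …, n}`. -/
def ident {n : ℕ} (i : Fin n) : ℕ := i.val + 1

/-- Univariate integer polynomials of degree at most `t`. -/
abbrev Poly (t : ℕ) : Type := {f : Polynomial ℤ // f.natDegree ≤ t}

/-- The value `f (j)` at the identifier of process `j`. -/
noncomputable def Poly.at {n t : ℕ} (f : Poly t) (j : Fin n) : ℤ :=
  f.1.eval (ident j : ℤ)

/-- `g` is a symmetric bivariate polynomial of degree at most `t` (in each variable). -/
def IsSymBivariate {R : Type} [CommRing R] (t : ℕ) (g : Polynomial (Polynomial R)) : Prop :=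
  g.natDegree ≤ t ∧ (∀ a, (g.coeff a).natDegree ≤ t) ∧
    ∀ a b, (g.coeff a).coeff b = (g.coeff b).coeff a

/-! ### Invocations, broadcasts, messages -/

/-- The name of an invocation of IVSS[`round`]: its round, its dealer and a counter. -/
structure Inst (n : ℕ) where
  round : ℕ
  dealer : Fin n
  index : ℕ
deriving DecidableEq

/-- What an A-Cast is about. Together with its sender, the topic names one A-Cast instance. -/
inductive Topic (n : ℕ) where
  /-- A-Cast by `k`: the statement "equal: (k, i)" in invocation `I`. -/
  | equal (I : Inst n) (i : Fin n)
  /-- A-Cast by the dealer of `I`: the candidate set of `I`. -/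
  | candidate (I : Inst n)
  /-- A-Cast by a member of the candidate set of `I`: its polynomial in `I`. -/
  | poly (I : Inst n)
  /-- The statement "ready to complete" in `I`. -/
  | readyToComplete (I : Inst n)
  /-- A-Cast by `k`: its set `CoreInvocations` of round `r`. -/
  | core (r : ℕ)
  /-- A-Cast by `k`: the statement "checked_r : k, l, e" about the unordered pair `e`. -/
  | checked (r : ℕ) (l : Fin n) (e : Sym2 (Fin n))

/-- The type of the value that is A-Cast. -/
def Topic.Val {n : ℕ} (t : ℕ) : Topic n → Type
  | .equal _ _ => Unit
  | .candidate _ => Finset (Fin n)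
  | .poly _ => Poly t
  | .readyToComplete _ => Unit
  | .core _ => Finset (Inst n)
  | .checked _ _ _ => Unit

/-- The contents of messages. -/
inductive Msg (n t : ℕ) where
  /-- The dealer of `I` sends a polynomial. -/
  | deal (I : Inst n) (f : Poly t)
  /-- Process `k` sends the value of its polynomial at `i` to process `i`. -/
  | value (I : Inst n) (v : ℤ)
  /-- A-Cast: the sender distributes its input `u`. -/
  | msg (T : Topic n) (u : T.Val t)
  /-- A-Cast of sender `s` on topic `T`: "echo: u". -/
  | echo (s : Fin n) (T : Topic n) (u : T.Val t)
  /-- A-Cast of sender `s` on topic `T`: "ready: u". -/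
  | ready (s : Fin n) (T : Topic n) (u : T.Val t)

/-- A message with its (authentic) source and its destination. -/
structure Packet (n t : ℕ) where
  src : Fin n
  dst : Fin n
  msg : Msg n t

/-- The message `m`, sent by `k` to all processes. -/
def toAll {n t : ℕ} (k : Fin n) (m : Msg n t) : Set (Packet n t) :=
  {p | p.src = k ∧ p.msg = m}

/-! ### Configurations -/

/-- The local variables of a process. -/
structure LocalState (n t : ℕ) where
  /-- The current round (`0` before round `1` has begun). -/
  round : ℕ
  /-- The polynomial that was accepted from the dealer of an invocation. -/
  share : Inst n → Option (Poly t)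
  /-- The value obtained by interpolation in the reconstruction phase of an invocation. -/
  interp : Inst n → Option ℚ
  /-- `core r` is the set `CoreInvocations` of round `r`. -/
  core : ℕ → Finset (Inst n)

/-- A global configuration: local variables, messages sent so far, messages received so far. -/
structure Config (n t : ℕ) where
  loc : Fin n → LocalState n t
  sent : Set (Packet n t)
  rcvd : Set (Packet n t)

/-- The configuration in which every execution starts. -/
def Config.start (n t : ℕ) : Config n t where
  loc := fun _ => ⟨0, fun _ => none, fun _ => none, fun _ => ∅⟩
  sent := ∅
  rcvd := ∅

variable {n t : ℕ}

/-- Add messages to the network. -/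
def Config.post (c : Config n t) (P : Set (Packet n t)) : Config n t :=
  { c with sent := c.sent ∪ P }

/-- Change the local variables of `k`. -/
def Config.setLoc (c : Config n t) (k : Fin n) (s : LocalState n t) : Config n t :=
  { c with loc := Function.update c.loc k s }

/-- Process `k` starts an A-Cast of the value `u` on topic `T`. -/
def Config.acast (c : Config n t) (k : Fin n) (T : Topic n) (u : T.Val t) : Config n t :=
  c.post (toAll k (.msg T u))

/-- Process `k` has received the value `u` from the A-Cast of `s` on topic `T`, i.e. it has received
"ready: u" in this A-Cast from `2 t + 1` processes. -/
def Delivered (c : Config n t) (k s : Fin n) (T : Topic n) (u : T.Val t) : Prop :=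
  ∃ Q : Finset (Fin n), 2 * t + 1 ≤ Q.card ∧ ∀ i ∈ Q, ⟨i, k, .ready s T u⟩ ∈ c.rcvd

/-! ### Local conditions of the protocol -/

/-- The conditions, evaluated at `k`, under which `M` is accepted as candidate set of `I`. -/
def CandidateOK (c : Config n t) (k : Fin n) (I : Inst n) (M : Finset (Fin n)) : Prop :=
  M.card = n - t ∧
  (∀ i ∈ M, ∀ j ∈ M, Delivered c k i (.equal I j) ()) ∧
  (∀ i ∈ M, ∀ j ∈ M, ∀ p ∈ M, ∀ q ∈ M, Delivered c k p (.checked I.round q s(i, j)) ())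

/-- Process `k` has completed the sharing protocol of `I`, with candidate set `M`. -/
def SharingDone (c : Config n t) (k : Fin n) (I : Inst n) (M : Finset (Fin n)) : Prop :=
  Delivered c k I.dealer (.candidate I) M ∧ CandidateOK c k I M

/-- The set `FP` of the faulty pairs that process `k` has inferred. -/
def FP (c : Config n t) (k : Fin n) : Set (Sym2 (Fin n)) :=
  {e | ∃ (l : Fin n) (r : ℕ) (S : Finset (Inst n)) (I : Inst n) (M : Finset (Fin n))
      (i j : Fin n) (fi fj : Poly t),
    Delivered c k l (.core r) S ∧ I ∈ S ∧ Delivered c k I.dealer (.candidate I) M ∧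
    i ∈ M ∧ j ∈ M ∧ Delivered c k i (.poly I) fi ∧ Delivered c k j (.poly I) fj ∧
    fi.at j ≠ fj.at i ∧ e = s(i, j)}

/-- The conditions, evaluated at `k`, under which `k` A-Casts "checked_r : k, l, e": it has
received the sets `CoreInvocations` of `l` of all rounds before `r`; for each invocation in them it
knows the candidate set and has received the polynomial of each member of `e` in it; and it has not
inferred that `e` is a faulty pair. -/
def CheckOK (c : Config n t) (k : Fin n) (r : ℕ) (l : Fin n) (e : Sym2 (Fin n)) : Prop :=
  (∀ r' < r, ∃ S : Finset (Inst n), Delivered c k l (.core r') S) ∧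
  (∀ r' < r, ∀ S : Finset (Inst n), Delivered c k l (.core r') S → ∀ I ∈ S,
    ∃ M : Finset (Fin n), Delivered c k I.dealer (.candidate I) M ∧
      ∀ i ∈ e, i ∈ M → ∃ f : Poly t, Delivered c k i (.poly I) f) ∧
  e ∉ FP c k

/-- At process `k`, the polynomials received from some `n - 2 t` members of the candidate set `M` of
`I` are interpolated by a symmetric bivariate polynomial whose value at `(0, 0)` is `v`. -/
def Interpolates (c : Config n t) (k : Fin n) (I : Inst n) (M : Finset (Fin n)) (v : ℚ) : Prop :=
  ∃ (IS : Finset (Fin n)) (f : Fin n → Poly t) (g : Polynomial (Polynomial ℚ)),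
    IS ⊆ M ∧ IS.card = n - 2 * t ∧ (∀ i ∈ IS, Delivered c k i (.poly I) (f i)) ∧
    IsSymBivariate t g ∧
    (∀ i ∈ IS, ∀ j ∈ M, g.evalEval (ident i : ℚ) (ident j : ℚ) = ((f i).at j : ℚ)) ∧
    g.evalEval 0 0 = v

/-- Process `k` has completed the reconstruction protocol of `I` with output `v`. -/
def Outputs (c : Config n t) (k : Fin n) (I : Inst n) (v : ℚ) : Prop :=
  (c.loc k).interp I = some v ∧
  ∃ Q : Finset (Fin n), n - t ≤ Q.card ∧ ∀ i ∈ Q, Delivered c k i (.readyToComplete I) ()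

/-! ### Executions -/

/-- The atomic steps when `F` is the set of faulty processes. The steps of the correct processes are
those of the protocols A-Cast, IVSS-sharing, IVSS-reconstruction and certification; when they
take part in which invocation, and when they pass to the next round, is left open. -/
inductive Step (F : Finset (Fin n)) : Config n t → Config n t → Prop
  /-- A message that was sent is received. -/
  | receive (c : Config n t) (p : Packet n t) (hp : p ∈ c.sent) :
      Step F c { c with rcvd := insert p c.rcvd }
  /-- A faulty process sends an arbitrary message. -/
  | byzantine (c : Config n t) (p : Packet n t) (hp : p.src ∈ F) :
      Step F c (c.post {p})
  /-- A-Cast: on the first "msg: u" from the sender, send "echo: u" to all. -/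
  | echo (c : Config n t) (k s : Fin n) (T : Topic n) (u : T.Val t) (hk : k ∉ F)
      (hu : ⟨s, k, .msg T u⟩ ∈ c.rcvd)
      (hnew : ∀ (j : Fin n) (u' : T.Val t), ⟨k, j, .echo s T u'⟩ ∉ c.sent) :
      Step F c (c.post (toAll k (.echo s T u)))
  /-- A-Cast: on `n - t` messages "echo: u", send "ready: u" to all. -/
  | readyOfEcho (c : Config n t) (k s : Fin n) (T : Topic n) (u : T.Val t) (hk : k ∉ F)
      (Q : Finset (Fin n)) (hQ : n - t ≤ Q.card) (hu : ∀ i ∈ Q, ⟨i, k, .echo s T u⟩ ∈ c.rcvd) :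
      Step F c (c.post (toAll k (.ready s T u)))
  /-- A-Cast: on `t + 1` messages "ready: u", send "ready: u" to all. -/
  | readyOfReady (c : Config n t) (k s : Fin n) (T : Topic n) (u : T.Val t) (hk : k ∉ F)
      (Q : Finset (Fin n)) (hQ : t + 1 ≤ Q.card) (hu : ∀ i ∈ Q, ⟨i, k, .ready s T u⟩ ∈ c.rcvd) :
      Step F c (c.post (toAll k (.ready s T u)))
  /-- Certification: process `k` begins its next round `r`, with empty `CoreInvocations` of round
  `r`, and A-Casts its `CoreInvocations` of round `r - 1`. -/
  | nextRound (c : Config n t) (k : Fin n) (hk : k ∉ F) :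
      Step F c
        ((c.setLoc k { c.loc k with
            round := (c.loc k).round + 1
            core := Function.update (c.loc k).core ((c.loc k).round + 1) ∅ }).acast
          k (.core (c.loc k).round) ((c.loc k).core (c.loc k).round))
  /-- Certification: A-Cast "checked_r : k, l, e". -/
  | check (c : Config n t) (k : Fin n) (r : ℕ) (l : Fin n) (e : Sym2 (Fin n)) (hk : k ∉ F)
      (hr : 1 ≤ r) (h : CheckOK c k r l e) :
      Step F c (c.acast k (.checked r l e) ())
  /-- Sharing: the dealer chooses `f`, with secret `f (0, 0)`, and sends `f (i, y)` to each `i`. -/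
  | deal (c : Config n t) (I : Inst n) (hk : I.dealer ∉ F)
      (hround : (c.loc I.dealer).round = I.round) (hr : 1 ≤ I.round)
      (hnew : ∀ (j : Fin n) (q : Poly t), ⟨I.dealer, j, .deal I q⟩ ∉ c.sent)
      (f : Polynomial (Polynomial ℤ)) (hf : IsSymBivariate t f) (p : Fin n → Poly t)
      (hp : ∀ (i : Fin n) (y : ℤ), (p i).1.eval y = f.evalEval (ident i : ℤ) y) :
      Step F c (c.post {x | x.src = I.dealer ∧ x.msg = .deal I (p x.dst)})
  /-- Sharing: on receiving its polynomial from the dealer, `k` sends its value at `i` to each `i`.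
  Only one polynomial is accepted. -/
  | accept (c : Config n t) (k : Fin n) (I : Inst n) (f : Poly t) (hk : k ∉ F)
      (hf : ⟨I.dealer, k, .deal I f⟩ ∈ c.rcvd) (hnew : (c.loc k).share I = none) :
      Step F c
        ((c.setLoc k { c.loc k with
            share := Function.update (c.loc k).share I (some f) }).post
          {x | x.src = k ∧ x.msg = .value I (f.at x.dst)})
  /-- Sharing: `k` A-Casts "equal: (k, i)". -/
  | equal (c : Config n t) (k i : Fin n) (I : Inst n) (f : Poly t) (hk : k ∉ F)
      (hf : (c.loc k).share I = some f) (hv : ⟨i, k, .value I (f.at i)⟩ ∈ c.rcvd) :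
      Step F c (c.acast k (.equal I i) ())
  /-- Sharing: the dealer A-Casts a candidate set. -/
  | candidate (c : Config n t) (I : Inst n) (M : Finset (Fin n)) (hk : I.dealer ∉ F)
      (hM : CandidateOK c I.dealer I M)
      (hnew : ∀ (j : Fin n) (M' : Finset (Fin n)),
        ⟨I.dealer, j, .msg (.candidate I) M'⟩ ∉ c.sent) :
      Step F c (c.acast I.dealer (.candidate I) M)
  /-- Reconstruction: a member `k` of the candidate set A-Casts its polynomial. -/
  | castPoly (c : Config n t) (k : Fin n) (I : Inst n) (M : Finset (Fin n)) (f : Poly t)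
      (hk : k ∉ F) (hM : SharingDone c k I M) (hkM : k ∈ M) (hf : (c.loc k).share I = some f) :
      Step F c (c.acast k (.poly I) f)
  /-- Reconstruction: process `k`, being in the round of `I`, interpolates the value `v`, adds `I`
  to its `CoreInvocations` of this round and A-Casts "ready to complete". -/
  | interpolate (c : Config n t) (k : Fin n) (I : Inst n) (M : Finset (Fin n)) (v : ℚ)
      (hk : k ∉ F) (hround : (c.loc k).round = I.round) (hr : 1 ≤ I.round)
      (hM : SharingDone c k I M) (hnew : (c.loc k).interp I = none)
      (hv : Interpolates c k I M v) :
      Step F c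
        ((c.setLoc k { c.loc k with
            interp := Function.update (c.loc k).interp I (some v)
            core := Function.update (c.loc k).core I.round
              (insert I ((c.loc k).core I.round)) }).acast
          k (.readyToComplete I) ())

/-- `ρ` is a (finite or infinite) execution with set `F` of faulty processes; a finite execution
remains in its last configuration. -/
def IsExecution (F : Finset (Fin n)) (ρ : ℕ → Config n t) : Prop :=
  ρ 0 = Config.start n t ∧ ∀ m, ρ (m + 1) = ρ m ∨ Step F (ρ m) (ρ (m + 1))

/-! ### The error event -/

/-- `v` is the secret defined by the invocation `I` with candidate set `M`: the value at `(0, 0)` of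
the symmetric bivariate polynomial that interpolates the polynomials which the correct members of
`M` accepted from the dealer. -/
def IsSecret (F : Finset (Fin n)) (c : Config n t) (I : Inst n) (M : Finset (Fin n)) (v : ℚ) :
    Prop :=
  ∃ g : Polynomial (Polynomial ℚ), IsSymBivariate t g ∧
    (∀ i ∈ M \ F, ∃ f : Poly t, (c.loc i).share I = some f ∧
      ∀ j ∈ M \ F, g.evalEval (ident i : ℚ) (ident j : ℚ) = (f.at j : ℚ)) ∧
    g.evalEval 0 0 = v

/-- The event that some correct process outputs a value other than the secret defined by `I`. -/
def ErrorOccurs (F : Finset (Fin n)) (c : Config n t) (I : Inst n) : Prop :=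
  ∃ (k : Fin n) (M : Finset (Fin n)) (v : ℚ),
    k ∉ F ∧ SharingDone c k I M ∧ Outputs c k I v ∧ ¬ IsSecret F c I M v

/-- The rounds `r` such that the error event occurs in some invocation of IVSS[`r`]. -/
def errorRounds (F : Finset (Fin n)) (ρ : ℕ → Config n t) : Set ℕ :=
  {r | ∃ (I : Inst n) (m : ℕ), I.round = r ∧ ErrorOccurs F (ρ m) I}

end IVSS

/-! Suppose an instance with candidate set `M` errs. The correct members of `M`, at least `t + δ` of
them, hold rows of one symmetric polynomial `g`. The wrong output comes from a symmetric `h` that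
fits the polynomials A-Cast by `t + δ` members. Since `g (0, 0) ≠ h (0, 0)`, at most `t` members
have the same row in `g` and `h`. Any other member `i` deviates from `g` or from `h` in the
polynomial it A-Casts, and distinct polynomials of degree at most `t` agree at no more than `t`
identifiers. So `i` conflicts with at least `δ` members (`IsExecution.exists_conflicts`).

A conflicting pair never reappears in the candidate set of a later round
(`IsExecution.not_conflict`). The `n - t` processes that were ready to complete and the later
candidate set share a correct process. Its own certified history contains the erring instance, so it
must have compared the two polynomials before it vouched for the pair.

Counting finishes the proof (`card_mul_le_of_conflicts`). For a fixed `i`, the conflict sets of all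
its bad rounds but the last are disjoint and avoid the last candidate set, whose complement has `t`
elements. Hence `i` is bad in at most `(t + δ) / δ` rounds, while every error round has at least `t
+ δ` bad members among the `n` processes. -/

namespace IVSS

variable {n t : ℕ} {F : Finset (Fin n)} {c c' : Config n t} {k j s : Fin n} {I : Inst n}

/-! ### Effect of a single step on messages and local variables -/

namespace Step

theorem sent_mono (h : Step F c c') : c.sent ⊆ c'.sent := by
  cases h <;> simp [Config.post, Config.acast, Config.setLoc]

theorem rcvd_mono (h : Step F c c') : c.rcvd ⊆ c'.rcvd := by
  cases h <;> simp [Config.post, Config.acast, Config.setLoc]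

theorem rcvd_subset_sent (h : Step F c c') (hc : c.rcvd ⊆ c.sent) : c'.rcvd ⊆ c'.sent := by
  cases h
  case receive p hp => exact Set.insert_subset hp hc
  all_goals exact hc.trans Set.subset_union_left

/-- The possible changes of the local variables of a process. -/
theorem loc_cases (h : Step F c c') (k : Fin n) :
    c'.loc k = c.loc k ∨
    c'.loc k = { c.loc k with
      round := (c.loc k).round + 1
      core := Function.update (c.loc k).core ((c.loc k).round + 1) ∅ } ∨
    (∃ I f, (c.loc k).share I = none ∧ c'.loc k = { c.loc k with
      share := Function.update (c.loc k).share I (some f) }) ∨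
    ∃ I v M, (c.loc k).round = I.round ∧ (c.loc k).interp I = none ∧ SharingDone c k I M ∧
      Interpolates c k I M v ∧ c'.loc k = { c.loc k with
        interp := Function.update (c.loc k).interp I (some v)
        core := Function.update (c.loc k).core I.round (insert I ((c.loc k).core I.round)) } := by
  cases h
  case nextRound k' _ =>
    rcases eq_or_ne k k' with rfl | h
    · exact Or.inr (Or.inl (Function.update_self ..))
    · exact Or.inl (Function.update_of_ne h ..)
  case accept k' I f _ _ hnew =>
    rcases eq_or_ne k k' with rfl | h
    · exact Or.inr (Or.inr (Or.inl ⟨I, f, hnew, Function.update_self ..⟩))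
    · exact Or.inl (Function.update_of_ne h ..)
  case interpolate k' I M v _ hround _ hM hnew hv =>
    rcases eq_or_ne k k' with rfl | h
    · exact Or.inr (Or.inr (Or.inr ⟨I, v, M, hround, hnew, hM, hv, Function.update_self ..⟩))
    · exact Or.inl (Function.update_of_ne h ..)
  all_goals exact Or.inl rfl

theorem share_mono (h : Step F c c') {f : Poly t} (hf : (c.loc k).share I = some f) :
    (c'.loc k).share I = some f := by
  rcases h.loc_cases k with h | h | ⟨J, g, hJ, h⟩ | ⟨J, v, M, -, -, -, -, h⟩ <;> rw [h]
  · exact hf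
  · exact hf
  · have hne : I ≠ J := by
      rintro rfl
      simp [hf] at hJ
    simpa [hne] using hf
  · exact hf

theorem round_mono (h : Step F c c') (k : Fin n) : (c.loc k).round ≤ (c'.loc k).round := by
  rcases h.loc_cases k with h | h | ⟨J, g, hJ, h⟩ | ⟨J, v, M, -, -, -, -, h⟩ <;> simp [h]

/-- Sets of past rounds are frozen: beginning a round resets only the new entry, and interpolation
adds only to the entry of the current round. -/
theorem core_eq (h : Step F c c') {r : ℕ} (hr : r < (c.loc k).round) :
    (c'.loc k).core r = (c.loc k).core r := by
  rcases h.loc_cases k with h | h | ⟨J, g, hJ, h⟩ | ⟨J, v, M, hJ, -, -, -, h⟩ <;> rw [h]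
  · exact Function.update_of_ne (by omega) ..
  · exact Function.update_of_ne (by omega) ..

theorem core_mono (h : Step F c c') {r : ℕ} (hr : r ≤ (c.loc k).round) :
    (c.loc k).core r ⊆ (c'.loc k).core r := by
  rcases h.loc_cases k with h | h | ⟨J, g, hJ, h⟩ | ⟨J, v, M, hJ, -, -, -, h⟩ <;> rw [h]
  · exact (Function.update_of_ne (by omega) ..).ge
  · rcases eq_or_ne r J.round with rfl | hne
    · simp
    · simp [hne]

theorem interp_new (h : Step F c c') {v : ℚ} (hv : (c'.loc k).interp I = some v) :
    (c.loc k).interp I = some v ∨ ∃ M, SharingDone c k I M ∧ Interpolates c k I M v := by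
  rcases h.loc_cases k with h | h | ⟨J, g, hJ, h⟩ | ⟨J, w, M, -, -, hM, hw, h⟩ <;> rw [h] at hv
  · exact Or.inl hv
  · exact Or.inl hv
  · exact Or.inl hv
  · rcases eq_or_ne I J with rfl | hne
    · simp only [Function.update_self, Option.some.injEq] at hv
      exact Or.inr ⟨M, hM, hv ▸ hw⟩
    · exact Or.inl (by simpa [hne] using hv)

/-- A new message from a correct process can only come from the protocol rule for that kind of
message, since `k ∉ F` excludes the Byzantine step. The absence of earlier echoes and the exact set
of new messages are recorded because uniqueness of echoes needs both. -/
theorem echo_new (h : Step F c c') (hk : k ∉ F) {T : Topic n} {u : T.Val t}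
    (hp : ⟨k, j, .echo s T u⟩ ∈ c'.sent) :
    ⟨k, j, .echo s T u⟩ ∈ c.sent ∨ (⟨s, k, .msg T u⟩ ∈ c.rcvd ∧
      (∀ (j : Fin n) (u' : T.Val t), ⟨k, j, .echo s T u'⟩ ∉ c.sent) ∧
      c'.sent = c.sent ∪ toAll k (.echo s T u)) := by
  cases h
  case receive => exact Or.inl hp
  case byzantine p hF =>
    rcases hp with hp | rfl
    · exact Or.inl hp
    · exact absurd hF hk
  all_goals
    rcases hp with hp | ⟨rfl, hm⟩
    · exact Or.inl hp
    cases hm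
  exact Or.inr ⟨‹_›, ‹_›, rfl⟩

theorem ready_new (h : Step F c c') (hk : k ∉ F) {T : Topic n} {u : T.Val t}
    (hp : ⟨k, j, .ready s T u⟩ ∈ c'.sent) :
    ⟨k, j, .ready s T u⟩ ∈ c.sent ∨
      (∃ Q : Finset (Fin n), n - t ≤ Q.card ∧ ∀ i ∈ Q, ⟨i, k, .echo s T u⟩ ∈ c.rcvd) ∨
      (∃ Q : Finset (Fin n), t + 1 ≤ Q.card ∧ ∀ i ∈ Q, ⟨i, k, .ready s T u⟩ ∈ c.rcvd) := by
  cases h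
  case receive => exact Or.inl hp
  case byzantine p hF =>
    rcases hp with hp | rfl
    · exact Or.inl hp
    · exact absurd hF hk
  all_goals
    rcases hp with hp | ⟨rfl, hm⟩
    · exact Or.inl hp
    cases hm
  · exact Or.inr (Or.inl ⟨_, ‹_›, ‹_›⟩)
  · exact Or.inr (Or.inr ⟨_, ‹_›, ‹_›⟩)

theorem value_new (h : Step F c c') (hk : k ∉ F) {v : ℤ}
    (hp : ⟨k, j, .value I v⟩ ∈ c'.sent) :
    ⟨k, j, .value I v⟩ ∈ c.sent ∨ ∃ f, (c'.loc k).share I = some f ∧ v = f.at j := by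
  cases h
  case receive => exact Or.inl hp
  case byzantine p hF =>
    rcases hp with hp | rfl
    · exact Or.inl hp
    · exact absurd hF hk
  case accept k' I' f _ _ _ =>
    rcases hp with hp | ⟨hsrc, hm⟩
    · exact Or.inl hp
    obtain rfl : k = k' := hsrc
    obtain ⟨rfl, rfl⟩ : I = I' ∧ v = f.at j := Msg.value.inj hm
    exact Or.inr ⟨f, by simp [Config.post, Config.setLoc], rfl⟩
  all_goals
    rcases hp with hp | ⟨rfl, hm⟩
    · exact Or.inl hp
    cases hm

theorem equal_new (h : Step F c c') (hk : k ∉ F) {i : Fin n}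
    (hp : ⟨k, j, .msg (.equal I i) ()⟩ ∈ c'.sent) :
    ⟨k, j, .msg (.equal I i) ()⟩ ∈ c.sent ∨
      ∃ f, (c.loc k).share I = some f ∧ ⟨i, k, .value I (f.at i)⟩ ∈ c.rcvd := by
  cases h
  case receive => exact Or.inl hp
  case byzantine p hF =>
    rcases hp with hp | rfl
    · exact Or.inl hp
    · exact absurd hF hk
  all_goals
    rcases hp with hp | ⟨rfl, hm⟩
    · exact Or.inl hp
    cases hm
  exact Or.inr ⟨_, ‹_›, ‹_›⟩

theorem poly_new (h : Step F c c') (hk : k ∉ F) {f : Poly t}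
    (hp : ⟨k, j, .msg (.poly I) f⟩ ∈ c'.sent) :
    ⟨k, j, .msg (.poly I) f⟩ ∈ c.sent ∨ (c.loc k).share I = some f := by
  cases h
  case receive => exact Or.inl hp
  case byzantine p hF =>
    rcases hp with hp | rfl
    · exact Or.inl hp
    · exact absurd hF hk
  all_goals
    rcases hp with hp | ⟨rfl, hm⟩
    · exact Or.inl hp
    cases hm
  exact Or.inr ‹_›

theorem checked_new (h : Step F c c') (hk : k ∉ F) {r : ℕ} {l : Fin n} {e : Sym2 (Fin n)}
    (hp : ⟨k, j, .msg (.checked r l e) ()⟩ ∈ c'.sent) :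
    ⟨k, j, .msg (.checked r l e) ()⟩ ∈ c.sent ∨ CheckOK c k r l e := by
  cases h
  case receive => exact Or.inl hp
  case byzantine p hF =>
    rcases hp with hp | rfl
    · exact Or.inl hp
    · exact absurd hF hk
  all_goals
    rcases hp with hp | ⟨rfl, hm⟩
    · exact Or.inl hp
    cases hm
  exact Or.inr ‹_›

theorem ready_to_complete_new (h : Step F c c') (hk : k ∉ F)
    (hp : ⟨k, j, .msg (.readyToComplete I) ()⟩ ∈ c'.sent) :
    ⟨k, j, .msg (.readyToComplete I) ()⟩ ∈ c.sent ∨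
      I ∈ (c'.loc k).core I.round ∧ I.round = (c'.loc k).round := by
  cases h
  case receive => exact Or.inl hp
  case byzantine p hF =>
    rcases hp with hp | rfl
    · exact Or.inl hp
    · exact absurd hF hk
  all_goals
    rcases hp with hp | ⟨rfl, hm⟩
    · exact Or.inl hp
    cases hm
  exact Or.inr (by simp [Config.acast, Config.post, Config.setLoc, *])

theorem core_new (h : Step F c c') (hk : k ∉ F) {r : ℕ} {S : Finset (Inst n)}
    (hp : ⟨k, j, .msg (.core r) S⟩ ∈ c'.sent) :
    ⟨k, j, .msg (.core r) S⟩ ∈ c.sent ∨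
      (c'.loc k).round = r + 1 ∧ S = (c'.loc k).core r := by
  cases h
  case receive => exact Or.inl hp
  case byzantine p hF =>
    rcases hp with hp | rfl
    · exact Or.inl hp
    · exact absurd hF hk
  case nextRound k' _ =>
    rcases hp with hp | ⟨hsrc, hm⟩
    · exact Or.inl hp
    obtain rfl : k = k' := hsrc
    obtain ⟨hT, hS⟩ := Msg.msg.inj hm
    obtain rfl : r = (c.loc k).round := Topic.core.inj hT
    obtain rfl : S = (c.loc k).core (c.loc k).round := eq_of_heq hS
    exact Or.inr (by simp [Config.acast, Config.post, Config.setLoc])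
  all_goals
    rcases hp with hp | ⟨rfl, hm⟩
    · exact Or.inl hp
    cases hm

end Step

theorem Delivered.mono (h : c.rcvd ⊆ c'.rcvd) {T : Topic n} {u : T.Val t}
    (hd : Delivered c k s T u) : Delivered c' k s T u := by
  obtain ⟨Q, hQ, hu⟩ := hd
  exact ⟨Q, hQ, fun i hi => h (hu i hi)⟩

theorem SharingDone.mono (h : c.rcvd ⊆ c'.rcvd) {M : Finset (Fin n)}
    (hd : SharingDone c k I M) : SharingDone c' k I M :=
  ⟨hd.1.mono h, hd.2.1, fun i hi j hj => (hd.2.2.1 i hi j hj).mono h,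
    fun i hi j hj p hp q hq => (hd.2.2.2 i hi j hj p hp q hq).mono h⟩

theorem Interpolates.mono (h : c.rcvd ⊆ c'.rcvd) {M : Finset (Fin n)} {v : ℚ}
    (hd : Interpolates c k I M v) : Interpolates c' k I M v := by
  obtain ⟨S, f, g, h1, h2, h3, h4⟩ := hd
  exact ⟨S, f, g, h1, h2, fun i hi => (h3 i hi).mono h, h4⟩

end IVSS

/-! ### Symmetric bivariate interpolation -/

namespace IVSS
open Polynomial

variable {n t : ℕ}

theorem ident_injective : Function.Injective fun i : Fin n => (ident i : ℚ) := by
  intro i j h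
  simp only [ident, Nat.cast_inj] at h
  exact Fin.ext (by omega)

theorem IsSymBivariate.evalEval_eq_sum {g : ℚ[X][X]} (hg : IsSymBivariate t g) (x y : ℚ) :
    g.evalEval x y = ∑ a ∈ Finset.range (t + 1), ∑ b ∈ Finset.range (t + 1),
      (g.coeff a).coeff b * x ^ b * y ^ a := by
  rw [evalEval, eval_eq_sum_range' (Nat.lt_succ_of_le hg.1), eval_finsetSum]
  refine Finset.sum_congr rfl fun a _ => ?_
  rw [eval_mul, eval_pow, eval_C, eval_eq_sum_range' (Nat.lt_succ_of_le (hg.2.1 a)),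
    Finset.sum_mul]

theorem IsSymBivariate.evalEval_comm {g : ℚ[X][X]} (hg : IsSymBivariate t g) (x y : ℚ) :
    g.evalEval x y = g.evalEval y x := by
  rw [hg.evalEval_eq_sum, hg.evalEval_eq_sum, Finset.sum_comm]
  refine Finset.sum_congr rfl fun a _ => Finset.sum_congr rfl fun b _ => ?_
  rw [hg.2.2 a b]
  ring

theorem IsSymBivariate.natDegree_eval_le {g : ℚ[X][X]} (hg : IsSymBivariate t g) (y : ℚ) :
    (g.eval (C y)).natDegree ≤ t := by
  rw [eval_eq_sum_range]
  refine natDegree_sum_le_of_forall_le _ _ fun a _ => ?_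
  rw [← C_pow]
  exact (natDegree_mul_C_le _ _).trans (hg.2.1 a)

/-- Polynomials of degree at most `t` that agree at more than `t` identifiers are equal. -/
theorem eq_of_eval_ident {p q : ℚ[X]} (hp : p.natDegree ≤ t) (hq : q.natDegree ≤ t)
    {S : Finset (Fin n)} (hS : t < S.card)
    (h : ∀ i ∈ S, p.eval (ident i : ℚ) = q.eval (ident i : ℚ)) : p = q := by
  have hd : ∀ {r : ℚ[X]}, r.natDegree ≤ t → r.degree < S.card := fun hr =>
    lt_of_le_of_lt (degree_le_of_natDegree_le hr) (by exact_mod_cast hS)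
  exact eq_of_degrees_lt_of_eval_index_eq S (fun i _ j _ hij => ident_injective hij) (hd hp) (hd hq) h

/-- The polynomial of a process, over the rationals. -/
noncomputable def Poly.toRat (f : Poly t) : ℚ[X] := f.1.map (Int.castRingHom ℚ)

theorem Poly.eval_toRat (f : Poly t) (j : Fin n) : f.toRat.eval (ident j : ℚ) = (f.at j : ℚ) := by
  have := eval_intCast_map (Int.castRingHom ℚ) f.1 (ident j : ℤ)
  simp only [eq_intCast, Int.cast_natCast] at this
  exact this

theorem Poly.natDegree_toRat_le (f : Poly t) : f.toRat.natDegree ≤ t :=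
  natDegree_map_le.trans f.2

/-- Pairwise consistent polynomials of more than `t` processes have a symmetric interpolant. -/
theorem exists_isSymBivariate {S : Finset (Fin n)} (hS : t < S.card) (f : Fin n → Poly t)
    (hf : ∀ i ∈ S, ∀ j ∈ S, (f i).at j = (f j).at i) :
    ∃ g : ℚ[X][X], IsSymBivariate t g ∧
      ∀ i ∈ S, ∀ j : Fin n, g.evalEval (ident i : ℚ) (ident j : ℚ) = ((f i).at j : ℚ) := by
  -- Exactly `t + 1` nodes, so that the Lagrange basis polynomials have degree `t`.
  obtain ⟨T, hTS, hT⟩ := Finset.exists_subset_card_eq (Nat.succ_le_of_lt hS)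
  let L : Fin n → ℚ[X] := fun a => Lagrange.basis T (fun i : Fin n => (ident i : ℚ)) a
  have hinj : Set.InjOn (fun i : Fin n => (ident i : ℚ)) T := fun i _ j _ h => ident_injective h
  have hL : ∀ a ∈ T, (L a).natDegree ≤ t := fun a ha =>
    natDegree_le_of_degree_le (by simp [L, Lagrange.degree_basis hinj ha, hT])
  -- Tensor product Lagrange interpolation on `T × T`: `L b` in the inner variable, `L a` in the
  -- outer one.
  let g : ℚ[X][X] := ∑ a ∈ T, ∑ b ∈ T, C (C ((f a).at b : ℚ) * L b) * (L a).map C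
  have hcoeff : ∀ l m, (g.coeff l).coeff m =
      ∑ a ∈ T, ∑ b ∈ T, ((f a).at b : ℚ) * ((L b).coeff m * (L a).coeff l) := by
    intro l m
    simp only [g, finsetSum_coeff, coeff_C_mul, coeff_map, coeff_mul_C, mul_assoc]
  have hg : IsSymBivariate t g := by
    refine ⟨?_, fun l => ?_, fun l m => ?_⟩
    · refine natDegree_sum_le_of_forall_le _ _ fun a ha =>
        natDegree_sum_le_of_forall_le _ _ fun b _ => ?_
      exact (natDegree_C_mul_le _ _).trans (natDegree_map_le.trans (hL a ha))
    · rw [natDegree_le_iff_coeff_eq_zero]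
      intro m hm
      rw [hcoeff]
      refine Finset.sum_eq_zero fun a _ => Finset.sum_eq_zero fun b hb => ?_
      rw [coeff_eq_zero_of_natDegree_lt ((hL b hb).trans_lt hm)]
      ring
    · rw [hcoeff, hcoeff, Finset.sum_comm]
      refine Finset.sum_congr rfl fun a ha => Finset.sum_congr rfl fun b hb => ?_
      rw [hf b (hTS hb) a (hTS ha)]
      ring
  have heval : ∀ x y, g.evalEval x y =
      ∑ a ∈ T, ∑ b ∈ T, ((f a).at b : ℚ) * (L b).eval x * (L a).eval y := by
    intro x y
    simp [g, evalEval, eval_finsetSum, eval_map, eval₂_at_apply]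
  have hrowT : ∀ a ∈ T, g.eval (C (ident a : ℚ)) = (f a).toRat := by
    intro a ha
    refine eq_of_eval_ident (hg.natDegree_eval_le _) (f a).natDegree_toRat_le
      (S := T) (by omega) fun b hb => ?_
    change g.evalEval (ident b : ℚ) (ident a : ℚ) = _
    have hb' : ∀ c ∈ T, ∀ d ∈ T, (L c).eval (ident d : ℚ) = if c = d then 1 else 0 := by
      intro c hc d hd
      split_ifs with h
      · subst h; exact Lagrange.eval_basis_self hinj hc
      · exact Lagrange.eval_basis_of_ne (v := fun i : Fin n => (ident i : ℚ)) h hd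
    rw [heval, Poly.eval_toRat, Finset.sum_eq_single_of_mem a ha, Finset.sum_eq_single_of_mem b hb]
    · simp [hb' b hb b hb, hb' a ha a ha]
    · intro d hd hdb
      simp [hb' d hd b hb, hdb]
    · intro d hd hda
      simp [hb' d hd a ha, hda]
  refine ⟨g, hg, fun i hi j => ?_⟩
  -- For `i` outside `T` the row is determined by its values at the nodes `b ∈ T`, which symmetry
  -- reads off the known rows of those `b`.
  have hrow : g.eval (C (ident i : ℚ)) = (f i).toRat := by
    refine eq_of_eval_ident (hg.natDegree_eval_le _) (f i).natDegree_toRat_le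
      (S := T) (by omega) fun b hb => ?_
    change g.evalEval (ident b : ℚ) (ident i : ℚ) = _
    rw [hg.evalEval_comm]
    change (g.eval (C (ident b : ℚ))).eval (ident i : ℚ) = _
    rw [hrowT b hb, Poly.eval_toRat, Poly.eval_toRat, hf i hi b (hTS hb)]
  rw [hg.evalEval_comm]
  change (g.eval (C (ident i : ℚ))).eval (ident j : ℚ) = _
  rw [hrow, Poly.eval_toRat]

/-! ### Counting conflicts over rounds -/

/-- A set of members of `M` that each conflict with `δ` members of `M`, in a family of sets
without earlier conflicts, bounds the number of sets. -/
theorem card_mul_le_of_conflicts {V : Type*} [Fintype V] [DecidableEq V] {t δ : ℕ}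
    (hV : Fintype.card V = 3 * t + δ) (hδ : 0 < δ) (R : Finset ℕ) (M A : ℕ → Finset V)
    (D : ℕ → V → Finset V) (hM : ∀ r ∈ R, (M r).card = 2 * t + δ)
    (hAM : ∀ r ∈ R, A r ⊆ M r) (hA : ∀ r ∈ R, t + δ ≤ (A r).card)
    (hDM : ∀ r ∈ R, ∀ i, D r i ⊆ M r) (hD : ∀ r ∈ R, ∀ i ∈ A r, δ ≤ (D r i).card)
    (hfree : ∀ r ∈ R, ∀ r' ∈ R, r < r' → ∀ i ∈ M r, i ∈ M r' → Disjoint (D r i) (M r')) :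
    R.card * δ ≤ 3 * t + δ := by
  -- All bad rounds of `i` except the last, `b`, use up `δ` new elements each of the complement of
  -- `M b`, which has `t` elements; round `b` itself accounts for the extra `δ`.
  have hgain : ∀ i : V, (R.filter (i ∈ A ·)).card * δ ≤ t + δ := by
    intro i
    set Ri := R.filter (i ∈ A ·)
    have hRi : ∀ r ∈ Ri, r ∈ R ∧ i ∈ A r := fun r hr => by simpa [Ri] using hr
    rcases Ri.eq_empty_or_nonempty with h | h
    · simp [h]
    set b := Ri.max' h
    have hb : b ∈ Ri := Ri.max'_mem h
    have hlt : ∀ r ∈ Ri.erase b, r < b := fun r hr =>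
      lt_of_le_of_ne (Ri.le_max' r (Finset.mem_of_mem_erase hr)) (Finset.ne_of_mem_erase hr)
    have hdis : ∀ r ∈ Ri, ∀ r' ∈ Ri, r < r' → Disjoint (D r i) (M r') := fun r hr r' hr' hrr =>
      hfree r (hRi r hr).1 r' (hRi r' hr').1 hrr i (hAM r (hRi r hr).1 (hRi r hr).2)
        (hAM r' (hRi r' hr').1 (hRi r' hr').2)
    have hpair : ((Ri.erase b : Finset ℕ) : Set ℕ).PairwiseDisjoint (D · i) := by
      intro r hr r' hr' hne
      have hr := Finset.mem_of_mem_erase hr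
      have hr' := Finset.mem_of_mem_erase hr'
      rcases lt_or_gt_of_ne hne with h' | h'
      · exact (hdis r hr r' hr' h').mono_right (hDM r' (hRi r' hr').1 i)
      · exact ((hdis r' hr' r hr h').mono_right (hDM r (hRi r hr).1 i)).symm
    have hsub : (Ri.erase b).biUnion (D · i) ⊆ (M b)ᶜ := by
      intro j hj
      obtain ⟨r, hr, hj⟩ := Finset.mem_biUnion.1 hj
      exact Finset.mem_compl.2
        (Finset.disjoint_left.1 (hdis r (Finset.mem_of_mem_erase hr) b hb (hlt r hr)) hj)
    have hcard := Finset.card_le_card hsub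
    rw [Finset.card_biUnion hpair, Finset.card_compl, hV, hM b (hRi b hb).1] at hcard
    have hle : (Ri.erase b).card * δ ≤ ∑ r ∈ Ri.erase b, (D r i).card := by
      rw [← smul_eq_mul]
      exact Finset.card_nsmul_le_sum _ _ _ fun r hr =>
        have hr := hRi r (Finset.mem_of_mem_erase hr)
        hD r hr.1 i hr.2
    have hcb := Finset.card_erase_add_one hb
    rw [← hcb, add_mul]
    omega
  -- Double counting of the pairs `(r, i)` with `i ∈ A r`.
  have hdouble : ∑ r ∈ R, (A r).card = ∑ i : V, (R.filter (i ∈ A ·)).card := by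
    simp only [Finset.card_filter]
    rw [Finset.sum_comm]
    simp
  have h1 : R.card * (t + δ) ≤ ∑ r ∈ R, (A r).card := by
    rw [← smul_eq_mul]
    exact Finset.card_nsmul_le_sum _ _ _ hA
  have h2 : (∑ i : V, (R.filter (i ∈ A ·)).card) * δ ≤ (3 * t + δ) * (t + δ) := by
    rw [Finset.sum_mul, ← hV, ← smul_eq_mul, ← Finset.card_univ]
    exact Finset.sum_le_card_nsmul _ _ _ fun i _ => hgain i
  have h3 : R.card * δ * (t + δ) ≤ (3 * t + δ) * (t + δ) := by
    rw [← hdouble] at h2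
    calc R.card * δ * (t + δ) = R.card * (t + δ) * δ := by ring
      _ ≤ _ := (Nat.mul_le_mul_right δ h1).trans h2
  exact Nat.le_of_mul_le_mul_right h3 (by omega)

end IVSS

/-! ### Invariants of reachable configurations and properties of A-Cast -/

namespace IVSS
open Polynomial

variable {n t δ : ℕ} {F : Finset (Fin n)} {c c' : Config n t} {k k' j s : Fin n} {I : Inst n}
  {ρ : ℕ → Config n t}

theorem exists_mem_notMem_of_lt_card (hF : F.card ≤ t) {Q : Finset (Fin n)} (hQ : t < Q.card) :
    ∃ i ∈ Q, i ∉ F :=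
  Finset.exists_mem_notMem_of_card_lt_card (hF.trans_lt hQ)

/-- The properties of reachable configurations on which the analysis of the protocol rests. -/
structure Invariant (F : Finset (Fin n)) (c : Config n t) : Prop where
  rcvd_sent : c.rcvd ⊆ c.sent
  echo_unique : ∀ k ∉ F, ∀ (j j' s : Fin n) (T : Topic n) (u u' : T.Val t),
    ⟨k, j, .echo s T u⟩ ∈ c.sent → ⟨k, j', .echo s T u'⟩ ∈ c.sent → u = u'
  echo_msg : ∀ k ∉ F, ∀ (j s : Fin n) (T : Topic n) (u : T.Val t),
    ⟨k, j, .echo s T u⟩ ∈ c.sent → ⟨s, k, .msg T u⟩ ∈ c.sent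
  ready_echo : ∀ k ∉ F, ∀ (j s : Fin n) (T : Topic n) (u : T.Val t),
    ⟨k, j, .ready s T u⟩ ∈ c.sent →
      ∃ Q : Finset (Fin n), n - t ≤ Q.card ∧ ∀ i ∈ Q, ∃ j, ⟨i, j, .echo s T u⟩ ∈ c.sent
  value_share : ∀ k ∉ F, ∀ (j : Fin n) (I : Inst n) (v : ℤ), ⟨k, j, .value I v⟩ ∈ c.sent →
    ∃ f, (c.loc k).share I = some f ∧ v = f.at j
  equal_share : ∀ k ∉ F, ∀ (j i : Fin n) (I : Inst n), ⟨k, j, .msg (.equal I i) ()⟩ ∈ c.sent →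
    ∃ f, (c.loc k).share I = some f ∧ ⟨i, k, .value I (f.at i)⟩ ∈ c.sent
  poly_share : ∀ k ∉ F, ∀ (j : Fin n) (I : Inst n) (f : Poly t),
    ⟨k, j, .msg (.poly I) f⟩ ∈ c.sent → (c.loc k).share I = some f
  ready_core : ∀ k ∉ F, ∀ (j : Fin n) (I : Inst n),
    ⟨k, j, .msg (.readyToComplete I) ()⟩ ∈ c.sent →
      I ∈ (c.loc k).core I.round ∧ I.round ≤ (c.loc k).round
  core_final : ∀ k ∉ F, ∀ (j : Fin n) (r : ℕ) (S : Finset (Inst n)),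
    ⟨k, j, .msg (.core r) S⟩ ∈ c.sent → r < (c.loc k).round ∧ S = (c.loc k).core r
  interp : ∀ (k : Fin n) (I : Inst n) (v : ℚ), (c.loc k).interp I = some v →
    ∃ M, SharingDone c k I M ∧ Interpolates c k I M v

theorem Invariant.start : Invariant F (Config.start n t) := by
  constructor <;> simp [Config.start]

theorem Invariant.step (hF : F.card ≤ t) (hc : Invariant F c) (h : Step F c c') :
    Invariant F c' where
  rcvd_sent := h.rcvd_subset_sent hc.rcvd_sent
  echo_unique k hk j j' s T u u' hu hu' := by
    rcases h.echo_new hk hu with h₁ | ⟨-, hnew, hsent⟩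
    · rcases h.echo_new hk hu' with h₂ | ⟨-, hnew, -⟩
      · exact hc.echo_unique k hk j j' s T u u' h₁ h₂
      · exact absurd h₁ (hnew _ _)
    · rw [hsent] at hu'
      rcases hu' with hu' | ⟨-, hm⟩
      · exact absurd hu' (hnew _ _)
      · cases hm
        rfl
  echo_msg k hk j s T u hu := by
    rcases h.echo_new hk hu with h₁ | ⟨h₁, -⟩
    · exact h.sent_mono (hc.echo_msg k hk j s T u h₁)
    · exact h.sent_mono (hc.rcvd_sent h₁)
  ready_echo k hk j s T u hu := by
    have lift : (∃ Q : Finset (Fin n), n - t ≤ Q.card ∧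
        ∀ i ∈ Q, ∃ j, ⟨i, j, .echo s T u⟩ ∈ c.sent) →
        ∃ Q : Finset (Fin n), n - t ≤ Q.card ∧ ∀ i ∈ Q, ∃ j, ⟨i, j, .echo s T u⟩ ∈ c'.sent :=
      fun ⟨Q, hQ, he⟩ => ⟨Q, hQ, fun i hi => (he i hi).imp fun j hj => h.sent_mono hj⟩
    rcases h.ready_new hk hu with h₁ | ⟨Q, hQ, he⟩ | ⟨Q, hQ, he⟩
    · exact lift (hc.ready_echo k hk j s T u h₁)
    · exact lift ⟨Q, hQ, fun i hi => ⟨k, hc.rcvd_sent (he i hi)⟩⟩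
    -- Among `t + 1` senders of "ready" one is correct, and its message already traces back to a
    -- quorum of echoes.
    · obtain ⟨i, hi, hiF⟩ := exists_mem_notMem_of_lt_card hF hQ
      exact lift (hc.ready_echo i hiF k s T u (hc.rcvd_sent (he i hi)))
  value_share k hk j I v hv := by
    rcases h.value_new hk hv with h₁ | h₁
    · obtain ⟨f, hf, hv⟩ := hc.value_share k hk j I v h₁
      exact ⟨f, h.share_mono hf, hv⟩
    · exact h₁
  equal_share k hk j i I hp := by
    rcases h.equal_new hk hp with h₁ | ⟨f, hf, hv⟩
    · obtain ⟨f, hf, hv⟩ := hc.equal_share k hk j i I h₁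
      exact ⟨f, h.share_mono hf, h.sent_mono hv⟩
    · exact ⟨f, h.share_mono hf, h.sent_mono (hc.rcvd_sent hv)⟩
  poly_share k hk j I f hp := by
    rcases h.poly_new hk hp with h₁ | h₁
    · exact h.share_mono (hc.poly_share k hk j I f h₁)
    · exact h.share_mono h₁
  ready_core k hk j I hp := by
    rcases h.ready_to_complete_new hk hp with h₁ | ⟨h₁, h₂⟩
    · obtain ⟨hI, hr⟩ := hc.ready_core k hk j I h₁
      exact ⟨h.core_mono hr hI, hr.trans (h.round_mono k)⟩
    · exact ⟨h₁, h₂.le⟩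
  core_final k hk j r S hp := by
    rcases h.core_new hk hp with h₁ | ⟨h₁, h₂⟩
    · obtain ⟨hr, hS⟩ := hc.core_final k hk j r S h₁
      exact ⟨hr.trans_le (h.round_mono k), hS.trans (h.core_eq hr).symm⟩
    · exact ⟨by omega, h₂⟩
  interp k I v hv := by
    have key : ∃ M, SharingDone c k I M ∧ Interpolates c k I M v := by
      rcases h.interp_new hv with h₁ | h₁
      · exact hc.interp k I v h₁
      · exact h₁
    obtain ⟨M, hM, hi⟩ := key
    exact ⟨M, hM.mono h.rcvd_mono, hi.mono h.rcvd_mono⟩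

theorem Invariant.exists_echo (hF : F.card ≤ t) (hc : Invariant F c) {T : Topic n}
    {u : T.Val t} (hd : Delivered c k s T u) :
    ∃ Q : Finset (Fin n), n - t ≤ Q.card ∧ ∀ i ∈ Q, ∃ j, ⟨i, j, .echo s T u⟩ ∈ c.sent := by
  obtain ⟨Q, hQ, hr⟩ := hd
  obtain ⟨i, hi, hiF⟩ := exists_mem_notMem_of_lt_card hF (Q := Q) (by omega)
  exact hc.ready_echo i hiF k s T u (hc.rcvd_sent (hr i hi))

/-- Agreement of A-Cast. -/
theorem Invariant.delivered_unique (hn : 3 * t < n) (hF : F.card ≤ t) (hc : Invariant F c)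
    {T : Topic n} {u u' : T.Val t} (hu : Delivered c k s T u) (hu' : Delivered c k' s T u') :
    u = u' := by
  obtain ⟨Q, hQ, he⟩ := hc.exists_echo hF hu
  obtain ⟨Q', hQ', he'⟩ := hc.exists_echo hF hu'
  have hcard := Finset.card_union_add_card_inter Q Q'
  have hle := (Q ∪ Q').card_le_univ
  rw [Fintype.card_fin] at hle
  -- Two quorums of `n - t` share at least `n - 2 t > t` processes.
  obtain ⟨i, hi, hiF⟩ := exists_mem_notMem_of_lt_card hF (Q := Q ∩ Q') (by omega)
  obtain ⟨j, hj⟩ := he i (Finset.mem_inter.1 hi).1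
  obtain ⟨j', hj'⟩ := he' i (Finset.mem_inter.1 hi).2
  exact hc.echo_unique i hiF j j' s T u u' hj hj'

/-- Integrity of A-Cast. -/
theorem Invariant.sent_of_delivered (hn : 3 * t < n) (hF : F.card ≤ t) (hc : Invariant F c)
    {T : Topic n} {u : T.Val t} (hu : Delivered c k s T u) : ∃ j, ⟨s, j, .msg T u⟩ ∈ c.sent := by
  obtain ⟨Q, hQ, he⟩ := hc.exists_echo hF hu
  obtain ⟨i, hi, hiF⟩ := exists_mem_notMem_of_lt_card hF (Q := Q) (by omega)
  obtain ⟨j, hj⟩ := he i hi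
  exact ⟨i, hc.echo_msg i hiF j s T u hj⟩

/-! ### Passing from single steps to executions -/

namespace IsExecution

theorem invariant (hρ : IsExecution F ρ) (hF : F.card ≤ t) (m : ℕ) : Invariant F (ρ m) := by
  induction m with
  | zero => exact hρ.1 ▸ Invariant.start
  | succ m ih =>
    rcases hρ.2 m with h | h
    · exact h ▸ ih
    · exact ih.step hF h

theorem sent_mono (hρ : IsExecution F ρ) {m m' : ℕ} (h : m ≤ m') : (ρ m).sent ⊆ (ρ m').sent := by
  refine monotone_nat_of_le_succ (f := fun m => (ρ m).sent) (fun m => ?_) h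
  rcases hρ.2 m with h | h
  · exact (congrArg Config.sent h).ge
  · exact h.sent_mono

theorem rcvd_mono (hρ : IsExecution F ρ) {m m' : ℕ} (h : m ≤ m') : (ρ m).rcvd ⊆ (ρ m').rcvd := by
  refine monotone_nat_of_le_succ (f := fun m => (ρ m).rcvd) (fun m => ?_) h
  rcases hρ.2 m with h | h
  · exact (congrArg Config.rcvd h).ge
  · exact h.rcvd_mono

theorem share_mono (hρ : IsExecution F ρ) {m m' : ℕ} (h : m ≤ m') {f : Poly t}
    (hf : ((ρ m).loc k).share I = some f) : ((ρ m').loc k).share I = some f := by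
  induction m', h using Nat.le_induction with
  | base => exact hf
  | succ m' _ ih =>
    rcases hρ.2 m' with h | h
    · exact h ▸ ih
    · exact h.share_mono ih

/-- `CheckOK` is not stable, because `FP` can grow later. So it is claimed only for the moment of
the A-Cast and is not part of `Invariant`. -/
theorem exists_checkOK (hρ : IsExecution F ρ) (hk : k ∉ F) {m r : ℕ} {l : Fin n}
    {e : Sym2 (Fin n)} (hp : ⟨k, j, .msg (.checked r l e) ()⟩ ∈ (ρ m).sent) :
    ∃ m', CheckOK (ρ m') k r l e := by
  induction m with
  | zero => simp [hρ.1, Config.start] at hp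
  | succ m ih =>
    rcases hρ.2 m with h | h
    · exact ih (h ▸ hp)
    · exact (h.checked_new hk hp).elim ih fun h => ⟨m, h⟩

theorem delivered_unique (hρ : IsExecution F ρ) (hn : 3 * t < n) (hF : F.card ≤ t) {m m' : ℕ}
    {T : Topic n} {u u' : T.Val t} (hu : Delivered (ρ m) k s T u)
    (hu' : Delivered (ρ m') k' s T u') : u = u' :=
  (hρ.invariant hF (max m m')).delivered_unique hn hF
    (hu.mono (hρ.rcvd_mono (le_max_left m m'))) (hu'.mono (hρ.rcvd_mono (le_max_right m m')))

/-- A polynomial received from a correct process is the one accepted from the dealer. -/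
theorem eq_share_of_delivered (hρ : IsExecution F ρ) (hn : 3 * t < n) (hF : F.card ≤ t)
    (hs : s ∉ F) {m m' : ℕ} {f f' : Poly t} (hf : ((ρ m).loc s).share I = some f)
    (hf' : Delivered (ρ m') k s (.poly I) f') : f' = f := by
  obtain ⟨j, hj⟩ := (hρ.invariant hF m').sent_of_delivered hn hF hf'
  have h₁ := hρ.share_mono (le_max_left m m') hf
  have h₂ := hρ.share_mono (le_max_right m m') ((hρ.invariant hF m').poly_share s hs j I f' hj)
  exact Option.some.inj (h₂.symm.trans h₁)

end IsExecution

/-! ### Conflicts caused by an error, and their exclusion from later rounds -/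

/-- In no two polynomials that are ever received from `i` and `j` in `I` do the values at `j`
and `i` agree. -/
def Conflict (ρ : ℕ → Config n t) (I : Inst n) (i j : Fin n) : Prop :=
  ∀ (m m' : ℕ) (k k' : Fin n) (fi fj : Poly t), Delivered (ρ m) k i (.poly I) fi →
    Delivered (ρ m') k' j (.poly I) fj → fi.at j ≠ fj.at i

/-- The candidate set of a later invocation contains no pair that conflicts in a reconstructed
one. -/
theorem IsExecution.not_conflict (hρ : IsExecution F ρ) (hn : 3 * t < n) (hF : F.card ≤ t)
    {I' : Inst n} {M M' : Finset (Fin n)} {v : ℚ} {m m' : ℕ} (hM : SharingDone (ρ m) k I M)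
    (hv : Outputs (ρ m) k I v) (hM' : SharingDone (ρ m') k' I' M') (hr : I.round < I'.round)
    {i j : Fin n} (hi : i ∈ M) (hj : j ∈ M) (hi' : i ∈ M') (hj' : j ∈ M') :
    ¬ Conflict ρ I i j := by
  intro hconf
  obtain ⟨-, Q, hQ, hready⟩ := hv
  have hcard := Finset.card_union_add_card_inter Q M'
  have hle := (Q ∪ M').card_le_univ
  rw [Fintype.card_fin] at hle
  have hM'card := hM'.2.1
  obtain ⟨q, hq, hqF⟩ := exists_mem_notMem_of_lt_card hF (Q := Q ∩ M') (by omega)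
  obtain ⟨hqQ, hqM⟩ := Finset.mem_inter.1 hq
  -- The process `q` occurs here both as the checker and as the owner of the checked sets: its check
  -- against its own history is enough.
  obtain ⟨p, hp⟩ := (hρ.invariant hF m').sent_of_delivered hn hF
    (hM'.2.2.2 i hi' j hj' q hqM q hqM)
  obtain ⟨a, hcore, hpoly, hFP⟩ := hρ.exists_checkOK hqF hp
  obtain ⟨S, hS⟩ := hcore I.round hr
  -- A correct `q` A-Casts its set only after leaving the round, when the set is final. The times
  -- `m` and `a` are not ordered, so both facts are compared at `max m a`.
  have hIS : I ∈ S := by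
    obtain ⟨x, hx⟩ := (hρ.invariant hF m).sent_of_delivered hn hF (hready q hqQ)
    obtain ⟨y, hy⟩ := (hρ.invariant hF a).sent_of_delivered hn hF hS
    have hinv := hρ.invariant hF (max m a)
    have h₁ := hinv.ready_core q hqF x I (hρ.sent_mono (le_max_left m a) hx)
    have h₂ := hinv.core_final q hqF y I.round S (hρ.sent_mono (le_max_right m a) hy)
    exact h₂.2 ▸ h₁.1
  obtain ⟨M₁, hM₁, hdel⟩ := hpoly I.round hr S hS I hIS
  obtain rfl : M₁ = M := hρ.delivered_unique hn hF hM₁ hM.1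
  obtain ⟨fi, hfi⟩ := hdel i (Sym2.mem_mk_left i j) hi
  obtain ⟨fj, hfj⟩ := hdel j (Sym2.mem_mk_right i j) hj
  exact hFP ⟨q, I.round, S, I, M₁, i, j, fi, fj, hS, hIS, hM₁, hi, hj, hfi, hfj,
    hconf a a q q fi fj hfi hfj, rfl⟩

theorem card_le_add_card_eval_ne {p q : ℚ[X]} (hp : p.natDegree ≤ t) (hq : q.natDegree ≤ t)
    (hpq : p ≠ q) (S : Finset (Fin n)) :
    S.card ≤ t + (S.filter fun i => p.eval (ident i : ℚ) ≠ q.eval (ident i : ℚ)).card := by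
  rw [← Finset.card_filter_add_card_filter_not (s := S)
    fun i => p.eval (ident i : ℚ) = q.eval (ident i : ℚ)]
  refine Nat.add_le_add_right (not_lt.1 fun h => hpq ?_) _
  exact eq_of_eval_ident hp hq h fun i hi => (Finset.mem_filter.1 hi).2

/-- A process whose polynomial deviates from `g` conflicts with `δ` of `t + δ` processes whose
polynomials conform to `g`. -/
theorem IsExecution.le_card_conflict (hρ : IsExecution F ρ) (hn : 3 * t < n) (hF : F.card ≤ t)
    {g : ℚ[X][X]} (hg : IsSymBivariate t g) {S M : Finset (Fin n)} (hSM : S ⊆ M)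
    (hS : t + δ ≤ S.card) {i : Fin n}
    (hgS : ∀ j ∈ S, ∀ (m : ℕ) (k : Fin n) (f : Poly t), Delivered (ρ m) k j (.poly I) f →
      g.evalEval (ident j : ℚ) (ident i : ℚ) = (f.at i : ℚ))
    {m : ℕ} {p : Poly t} (hp : Delivered (ρ m) k i (.poly I) p)
    (hpg : p.toRat ≠ g.eval (C (ident i : ℚ))) (D : Finset (Fin n))
    (hD : ∀ j ∈ M, Conflict ρ I i j → j ∈ D) : δ ≤ D.card := by
  -- At most `t` members of `S` are points of agreement; each of the remaining `δ` or more gives a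
  -- conflict, because its own polynomial follows `g` at `i`.
  have hcard := card_le_add_card_eval_ne p.natDegree_toRat_le (hg.natDegree_eval_le _) hpg S
  refine (Nat.le_of_add_le_add_left (hS.trans hcard)).trans
    (Finset.card_le_card fun j hj => ?_)
  obtain ⟨hjS, hne⟩ := Finset.mem_filter.1 hj
  refine hD j (hSM hjS) fun m₁ m₂ k₁ k₂ fi fj hfi hfj heq => hne ?_
  obtain rfl := hρ.delivered_unique hn hF hfi hp
  rw [Poly.eval_toRat, heq, ← hgS j hjS m₂ k₂ fj hfj]

/-- The polynomials accepted by the correct members of the candidate set are consistent. -/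
theorem Invariant.exists_share (hn : 3 * t < n) (hF : F.card ≤ t) (hc : Invariant F c)
    {M : Finset (Fin n)} (hM : SharingDone c k I M) :
    ∃ f : Fin n → Poly t, (∀ i ∈ M \ F, (c.loc i).share I = some (f i)) ∧
      ∀ i ∈ M \ F, ∀ j ∈ M \ F, (f i).at j = (f j).at i := by
  have key : ∀ i ∈ M \ F, ∀ j ∈ M \ F, ∃ fi fj : Poly t, (c.loc i).share I = some fi ∧
      (c.loc j).share I = some fj ∧ fi.at j = fj.at i := by
    intro i hi j hj
    obtain ⟨hiM, hiF⟩ := Finset.mem_sdiff.1 hi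
    obtain ⟨hjM, hjF⟩ := Finset.mem_sdiff.1 hj
    obtain ⟨x, hx⟩ := hc.sent_of_delivered hn hF (hM.2.2.1 i hiM j hjM)
    obtain ⟨fi, hfi, hv⟩ := hc.equal_share i hiF x j I hx
    obtain ⟨fj, hfj, hv⟩ := hc.value_share j hjF i I _ hv
    exact ⟨fi, fj, hfi, hfj, hv⟩
  have hex : ∀ i, ∃ f : Poly t, i ∈ M \ F → (c.loc i).share I = some f := by
    intro i
    by_cases hi : i ∈ M \ F
    · obtain ⟨f, -, hf, -⟩ := key i hi i hi
      exact ⟨f, fun _ => hf⟩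
    -- The zero polynomial is a dummy value outside the correct members.
    · exact ⟨⟨0, by simp⟩, fun h => absurd h hi⟩
  choose f hf using hex
  refine ⟨f, hf, fun i hi j hj => ?_⟩
  obtain ⟨fi, fj, hfi, hfj, h⟩ := key i hi j hj
  rwa [← Option.some.inj (hfi.symm.trans (hf i hi)), ← Option.some.inj (hfj.symm.trans (hf j hj))]

/-- If the error event occurs, then `t + δ` members of the candidate set conflict with `δ` members
each. -/
theorem IsExecution.exists_conflicts (hρ : IsExecution F ρ) (hδ : 0 < δ) (hn : n = 3 * t + δ)
    (hF : F.card ≤ t) {m : ℕ} {M : Finset (Fin n)} {v : ℚ} (hM : SharingDone (ρ m) k I M)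
    (hout : Outputs (ρ m) k I v) (hsec : ¬ IsSecret F (ρ m) I M v) :
    ∃ A ⊆ M, t + δ ≤ A.card ∧ ∀ i ∈ A, ∀ D : Finset (Fin n),
      (∀ j ∈ M, Conflict ρ I i j → j ∈ D) → δ ≤ D.card := by
  have hn' : 3 * t < n := by omega
  have hinv := hρ.invariant hF m
  have hMcard : M.card = 2 * t + δ := by rw [hM.2.1]; omega
  obtain ⟨f, hf, hff⟩ := hinv.exists_share hn' hF hM
  have hC : t + δ ≤ (M \ F).card := by
    have := Finset.le_card_sdiff F M
    omega
  obtain ⟨g, hg, hgf⟩ := exists_isSymBivariate (t := t) (by omega) f hff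
  obtain ⟨M', hM', S, f', h, hSM, hS, hf', hh, hhf, hhv⟩ := hinv.interp k I v hout.1
  obtain rfl : M' = M := hinv.delivered_unique hn' hF hM'.1 hM.1
  have hgh : g.evalEval 0 0 ≠ h.evalEval 0 0 := fun heq =>
    hsec ⟨g, hg, fun i hi => ⟨f i, hf i hi, fun j _ => hgf i hi j⟩, heq.trans hhv⟩
  set E := M'.filter fun i => g.eval (C (ident i : ℚ)) = h.eval (C (ident i : ℚ))
  -- By symmetry a common row at `i` gives agreement of the rows at `0` in the point `i`. More than
  -- `t` such points would make the rows at `0` equal, and with them the secrets.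
  have hEcard : E.card ≤ t := by
    by_contra! hlt
    have h0 : g.eval (C 0) = h.eval (C 0) := by
      refine eq_of_eval_ident (hg.natDegree_eval_le 0) (hh.natDegree_eval_le 0) hlt fun i hi => ?_
      change g.evalEval _ 0 = h.evalEval _ 0
      rw [hg.evalEval_comm, hh.evalEval_comm]
      exact congrArg (eval 0) (Finset.mem_filter.1 hi).2
    exact hgh (congrArg (eval 0) h0)
  refine ⟨M' \ E, Finset.sdiff_subset, ?_, fun i hi D hD => ?_⟩
  · have := Finset.le_card_sdiff E M'
    omega
  obtain ⟨hiM, hiE⟩ := Finset.mem_sdiff.1 hi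
  have hne : g.eval (C (ident i : ℚ)) ≠ h.eval (C (ident i : ℚ)) := fun heq =>
    hiE (Finset.mem_filter.2 ⟨hiM, heq⟩)
  by_cases hdel : ∃ (m : ℕ) (k : Fin n) (p : Poly t), Delivered (ρ m) k i (.poly I) p
  · obtain ⟨m₁, k₁, p, hp⟩ := hdel
    -- A polynomial that equals the row of `g` deviates from `h` and conflicts inside the
    -- interpolation set `S`; otherwise it conflicts with correct members.
    by_cases hpg : p.toRat = g.eval (C (ident i : ℚ))
    · refine hρ.le_card_conflict hn' hF hh hSM (by omega) (fun j hj m₂ k₂ fj hfj => ?_) hp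
        (hpg ▸ hne) D hD
      rw [hhf j hj i hiM, hρ.delivered_unique hn' hF hfj (hf' j hj)]
    · refine hρ.le_card_conflict hn' hF hg Finset.sdiff_subset hC
        (fun j hj m₂ k₂ fj hfj => ?_) hp hpg D hD
      rw [hgf j hj i, hρ.eq_share_of_delivered hn' hF (Finset.mem_sdiff.1 hj).2 (hf j hj) hfj]
  -- If no polynomial of `i` is ever received, `Conflict` holds vacuously with all `2 t + δ`
  -- members.
  · have hMD : M' ⊆ D := fun j hj =>
      hD j hj fun m₁ _ k₁ _ fi _ hfi => absurd ⟨m₁, k₁, fi, hfi⟩ hdel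
    have := Finset.card_le_card hMD
    omega

/-! ### The bound on the number of error rounds -/

/-- One erring instance is chosen per round. Working with an arbitrary finite set of error rounds
lets the same inequality give both finiteness and the bound. -/
theorem IsExecution.card_mul_le (hρ : IsExecution F ρ) (hδ : 0 < δ) (hn : n = 3 * t + δ)
    (hF : F.card ≤ t) (R : Finset ℕ) (hR : (R : Set ℕ) ⊆ errorRounds F ρ) :
    R.card * δ ≤ 3 * t + δ := by
  classical
  have hn' : 3 * t < n := by omega
  have key : ∀ r ∈ R, ∃ (M A : Finset (Fin n)) (D : Fin n → Finset (Fin n)),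
      (∃ (I : Inst n) (m : ℕ) (k : Fin n), I.round = r ∧ SharingDone (ρ m) k I M) ∧
      A ⊆ M ∧ t + δ ≤ A.card ∧ (∀ i, D i ⊆ M) ∧ (∀ i ∈ A, δ ≤ (D i).card) ∧
      ∀ (I' : Inst n) (m' : ℕ) (k' : Fin n) (M' : Finset (Fin n)), r < I'.round →
        SharingDone (ρ m') k' I' M' → ∀ i ∈ M, i ∈ M' → Disjoint (D i) M' := by
    intro r hr
    obtain ⟨I, m, rfl, k, M, v, -, hM, hout, hsec⟩ := hR hr
    obtain ⟨A, hAM, hA, hAD⟩ := hρ.exists_conflicts hδ hn hF hM hout hsec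
    refine ⟨M, A, fun i => M.filter (Conflict ρ I i), ⟨I, m, k, rfl, hM⟩, hAM, hA,
      fun i => Finset.filter_subset _ _,
      fun i hi => hAD i hi _ fun j hj h => Finset.mem_filter.2 ⟨hj, h⟩, ?_⟩
    intro I' m' k' M' hlt hM' i hi hi'
    refine Finset.disjoint_left.2 fun j hj hj' => ?_
    obtain ⟨hjM, hconf⟩ := Finset.mem_filter.1 hj
    exact hρ.not_conflict hn' hF hM hout hM' hlt hi hjM hi' hj' hconf
  choose! M A D hM hAM hA hDM hD hfree using key
  refine card_mul_le_of_conflicts (by simpa using hn) hδ R M A D (fun r hr => ?_) hAM hA hDM hD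
    fun r hr r' hr' hlt i hi hi' => ?_
  · obtain ⟨I, m, k, -, h⟩ := hM r hr
    rw [h.2.1]
    omega
  · obtain ⟨I', m', k', rfl, h⟩ := hM r' hr'
    exact hfree r hr I' m' k' _ hlt h i hi hi'

end IVSS

theorem mainTheorem6 (n t δ : ℕ) (hδ : 0 < δ) (hn : n = 3 * t + δ)
    (F : Finset (Fin n)) (hF : F.card ≤ t)
    (ρ : ℕ → IVSS.Config n t) (hρ : IVSS.IsExecution F ρ) :
    (IVSS.errorRounds F ρ).Finite ∧
      ((IVSS.errorRounds F ρ).ncard : ℚ) ≤ 3 * (t : ℚ) / (δ : ℚ) + 1 := by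
  have hfin : (IVSS.errorRounds F ρ).Finite := by
    by_contra hinf
    -- Since `δ ≥ 1`, the bound allows at most `3 t + δ` rounds, so one more is a contradiction.
    obtain ⟨R, hR, hcard⟩ := Set.Infinite.exists_subset_card_eq hinf (3 * t + δ + 1)
    have h := hρ.card_mul_le hδ hn hF R hR
    have := Nat.le_mul_of_pos_right R.card hδ
    omega
  refine ⟨hfin, ?_⟩
  have h := hρ.card_mul_le hδ hn hF hfin.toFinset (by simp)
  rw [← Set.ncard_eq_toFinset_card _ hfin] at h
  have hδ' : (0 : ℚ) < δ := by exact_mod_cast hδ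
  rw [← sub_le_iff_le_add, le_div_iff₀ hδ', sub_mul, one_mul, sub_le_iff_le_add]
  exact_mod_cast h
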